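/- Let $c_i=\frac{1}{i+1}\binom{2i}{i}$ denote the $i$-th Catalan number. Represent a set partition of $[n]=\{1,\dots,n\}$, whose blocks $B_1,B_2,\dots$ are arranged in increasing order of smallest elements, by its canonical word (restricted growth sequence) $\pi=\pi_1\pi_2\cdots\pi_n$, where $i\in B_{\pi_i}$ for each $i$. The partition is called non-crossing if this word has no subsequence of the form $abab$ with $a<b$. The successor of the letter $\pi_i$ is $\pi_{i+1}$ if $i<n$, and the successor of the last letter $\pi_n$ is the first letter $\pi_1$ (so for $n=1$ the single letter is its own successor). (a) For every $n\ge 0$, the number of non-crossing partitions of $[n]$ whose canonical word contains no two equal adjacent letters, where the first and last letters are considered adjacent (that is, no letter equals its successor), is $$K_n=\sum_{i=0}^n(-1)^{n-i}\binom{n}{i}c_i .$$ (b) For all $0\le j\le n$, the number of non-crossing partitions of $[n]$ in whose canonical word none of the letters $\pi_1,\dots,\pi_j$ equals its successor is $$\sum_{i=0}^j(-1)^i\binom{j}{i}c_{n-i}.$$ -/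

import Mathlib

open Finset

/-- Set partitions of `[n]` are elements of `Finpartition (univ : Finset (Fin n))`; the element
`k` of `[n] = {1, …, n}` is `k - 1 : Fin n`.

`canonicalWord P` is the canonical form `π₁ π₂ ⋯ πₙ` of `P`: if the blocks `B₁, B₂, …` of `P` are
arranged in increasing order of smallest elements, then the `i`-th letter is the index
(starting with `1`) of the block that contains `i`, that is, the number of blocks whose
smallest element is at most that of the block of `i`. -/
def canonicalWord {n : ℕ} (P : Finpartition (univ : Finset (Fin n))) (i : Fin n) : ℕ :=
  #{B ∈ P.parts | B.min ≤ (P.part i).min}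

/-- The word `w` has a subsequence `a b a b` with `a < b`. -/
def Contains1212 {n : ℕ} (w : Fin n → ℕ) : Prop :=
  ∃ i j k l : Fin n, i < j ∧ j < k ∧ k < l ∧ w i < w j ∧ w k = w i ∧ w l = w j

/-- A set partition is non-crossing if its canonical form avoids the pattern `1212`. -/
def IsNonCrossing {n : ℕ} (P : Finpartition (univ : Finset (Fin n))) : Prop :=
  ¬ Contains1212 (canonicalWord P)

/-- No two cyclically adjacent letters of `w` are equal: `finRotate n` sends each position to the
next one and the last position to the first one. -/
def NoEqualCyclicallyAdjacent {n : ℕ} (w : Fin n → ℕ) : Prop :=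
  ∀ i : Fin n, w i ≠ w (finRotate n i)

/-- None of the letters in the first `j` positions equals its successor; the successor of the last
letter (this only matters if `j = n`) is the first one. -/
def NoEqualSuccessorAmongFirst {n : ℕ} (j : ℕ) (w : Fin n → ℕ) : Prop :=
  ∀ i : Fin n, (i : ℕ) < j → w i ≠ w (finRotate n i)

/-- The number `K_n = ∑_{i=0}^n (-1)^{n-i} C(n,i) c_i`, with `c_i` the Catalan numbers. -/
def catalanDifference (n : ℕ) : ℤ :=
  ∑ i ∈ range (n + 1), (-1 : ℤ) ^ (n - i) * (n.choose i : ℤ) * (catalan i : ℤ)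

/-! Words are traded for equivalence relations on positions. Let `N(n, j)` be `nonCrossingCount n
j`. If position `j` (counted from `0`) is related to its cyclic successor, deleting it loses no
information, creates no crossing, and leaves the condition on the first `j` positions unchanged.
Hence `N(n+1, j) = N(n+1, j+1) + N(n, j)` (`nonCrossingCount_succ`). Cutting after the last element
of the block of `0` gives the Catalan recursion, so `N(n, 0) = catalan n`. The sum in (b) follows by
induction on `j` with Pascal's rule, and (a) is the case `j = n` read backwards. -/

/-! ### From canonical words to equivalence relations -/

section Finpartition

variable {n : ℕ} (P : Finpartition (univ : Finset (Fin n)))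

theorem Finpartition.parts_eq_image_part {α : Type*} [DecidableEq α] {s : Finset α}
    (P : Finpartition s) : P.parts = s.image P.part := by
  ext t
  rw [mem_image]
  constructor
  · intro ht
    obtain ⟨x, hx, rfl⟩ := P.part_surjOn ht
    exact ⟨x, hx, rfl⟩
  · rintro ⟨x, hx, rfl⟩
    exact P.part_mem.2 hx

theorem Finpartition.part_injective {α : Type*} [DecidableEq α] {s : Finset α} :
    Function.Injective (Finpartition.part : Finpartition s → α → Finset α) := by
  intro P Q h
  ext1
  rw [P.parts_eq_image_part, Q.parts_eq_image_part, h]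

open Classical in
/-- Partitions of a finite type correspond to equivalence relations on it. -/
noncomputable def finpartitionEquivSetoid (α : Type*) [Fintype α] [DecidableEq α] :
    Finpartition (univ : Finset α) ≃ Setoid α where
  toFun P := Setoid.ker P.part
  invFun r := Finpartition.ofSetoid r
  left_inv P := by
    apply Finpartition.part_injective
    funext a
    ext b
    convert! Finpartition.mem_part_ofSetoid_iff_rel (s := Setoid.ker P.part) (a := a) (b := b)
      using 1
    rw [P.mem_part_iff_part_eq_part (mem_univ _) (mem_univ _), eq_comm]
    rfl
  right_inv r := by
    ext a b
    rw [Setoid.ker_def, eq_comm, ← Finpartition.mem_part_iff_part_eq_part _ (mem_univ _)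
      (mem_univ _)]
    convert! Finpartition.mem_part_ofSetoid_iff_rel (s := r) (a := a) (b := b) using 1

theorem canonicalWord_le_iff (i j : Fin n) :
    canonicalWord P i ≤ canonicalWord P j ↔ (P.part i).min ≤ (P.part j).min := by
  constructor
  · intro h
    by_contra! hlt
    refine absurd h (not_le.2 (card_lt_card ((ssubset_iff_of_subset ?_).2 ⟨P.part i, ?_, ?_⟩)))
    · exact monotone_filter_right _ fun B _ hB => hB.trans hlt.le
    · exact mem_filter.2 ⟨P.part_mem.2 (mem_univ _), le_rfl⟩
    · exact fun hB => absurd (mem_filter.1 hB).2 (not_le.2 hlt)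
  · exact fun h => card_le_card (monotone_filter_right _ fun B _ hB => hB.trans h)

theorem part_eq_part_iff_min_eq (i j : Fin n) :
    P.part i = P.part j ↔ (P.part i).min = (P.part j).min := by
  refine ⟨fun h => by rw [h], fun h => ?_⟩
  obtain ⟨a, ha⟩ := min_of_mem (P.mem_part (mem_univ i))
  exact P.eq_of_mem_parts (P.part_mem.2 (mem_univ _)) (P.part_mem.2 (mem_univ _))
    (mem_of_min ha) (mem_of_min (h ▸ ha))

theorem canonicalWord_eq_iff (i j : Fin n) :
    canonicalWord P i = canonicalWord P j ↔ P.part i = P.part j := by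
  rw [part_eq_part_iff_min_eq, le_antisymm_iff, le_antisymm_iff, canonicalWord_le_iff,
    canonicalWord_le_iff]

/-- A relation on `Fin n` is non-crossing if interleaved related pairs are related to each
other. -/
def Setoid.NonCrossing {n : ℕ} (r : Setoid (Fin n)) : Prop :=
  ∀ i j k l : Fin n, i < j → j < k → k < l → r i k → r j l → r i j

/-- The condition `a < b` in the pattern costs nothing: if `i, j, k, l` interleave and the letter at
`j` is the smaller one, the least element `p` of the block of `j` precedes `i`, and `p, i, j, k` is
a `1212`. -/
theorem isNonCrossing_iff : IsNonCrossing P ↔ (Setoid.ker P.part).NonCrossing := by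
  constructor
  · intro h i j k l hij hjk hkl hik hjl
    rw [Setoid.ker_def, ← canonicalWord_eq_iff] at hik hjl ⊢
    rcases lt_trichotomy (canonicalWord P i) (canonicalWord P j) with hw | hw | hw
    · exact (h ⟨i, j, k, l, hij, hjk, hkl, hw, hik.symm, hjl.symm⟩).elim
    · exact hw
    · have hm := hw
      rw [← not_le, canonicalWord_le_iff, not_le] at hm
      obtain ⟨p, hp⟩ := min_of_mem (P.mem_part (mem_univ j))
      have hpi : p < i := by
        rw [hp] at hm
        exact WithTop.coe_lt_coe.1 (hm.trans_le (min_le (P.mem_part (mem_univ i))))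
      have hpj : canonicalWord P p = canonicalWord P j := by
        rw [canonicalWord_eq_iff, ← P.mem_part_iff_part_eq_part (mem_univ _) (mem_univ _)]
        exact mem_of_min hp
      exact (h ⟨p, i, j, k, hpi, hij, hjk, hpj ▸ hw, hpj.symm, hik.symm⟩).elim
  · rintro h ⟨i, j, k, l, hij, hjk, hkl, hw, hki, hlj⟩
    have := h i j k l hij hjk hkl
    simp only [Setoid.ker_def, ← canonicalWord_eq_iff] at this
    exact hw.ne (this hki.symm hlj.symm)

end Finpartition

/-! ### Pulling back relations; deleting a position related to its successor -/

namespace Setoid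

instance finite_of_finite (α : Type*) [Finite α] : Finite (Setoid α) :=
  Finite.of_injective (fun r : Setoid α => (r : α → α → Prop)) fun r s h => by
    ext a b
    exact iff_of_eq (congrFun (congrFun h a) b)

theorem NonCrossing.comap_strictMono {m n : ℕ} {r : Setoid (Fin n)} (hr : r.NonCrossing)
    {f : Fin m → Fin n} (hf : StrictMono f) : (r.comap f).NonCrossing :=
  fun i j k l hij hjk hkl hik hjl =>
    hr (f i) (f j) (f k) (f l) (hf hij) (hf hjk) (hf hkl) hik hjl

theorem NonCrossing.comap_monotone {m n : ℕ} {r : Setoid (Fin n)} (hr : r.NonCrossing)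
    {f : Fin m → Fin n} (hf : Monotone f) : (r.comap f).NonCrossing := by
  intro i j k l hij hjk hkl hik hjl
  rw [comap_rel] at *
  rcases (hf hij.le).eq_or_lt with h | h1
  · rw [h]
  rcases (hf hjk.le).eq_or_lt with h | h2
  · rwa [h]
  rcases (hf hkl.le).eq_or_lt with h | h3
  · rw [← h] at hjl
    exact r.trans hik (r.symm hjl)
  exact hr _ _ _ _ h1 h2 h3 hik hjl

/-- Adding a copy of the first position at the end preserves being non-crossing. -/
theorem NonCrossing.comap_of_last {n : ℕ} {r : Setoid (Fin (n + 1))} (hr : r.NonCrossing)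
    {f : Fin (n + 2) → Fin (n + 1)} (hf : ∀ x : Fin (n + 1), f x.castSucc = x)
    (hlast : f (Fin.last _) = 0) : (r.comap f).NonCrossing := by
  intro i j k l hij hjk hkl hik hjl
  rw [comap_rel] at *
  obtain ⟨k, rfl⟩ := Fin.exists_castSucc_eq.2 (hkl.trans_le (Fin.le_last _)).ne
  obtain ⟨j, rfl⟩ := Fin.exists_castSucc_eq.2 (hjk.trans (Fin.castSucc_lt_last k)).ne
  obtain ⟨i, rfl⟩ := Fin.exists_castSucc_eq.2 (hij.trans (Fin.castSucc_lt_last j)).ne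
  rw [Fin.castSucc_lt_castSucc_iff] at hij hjk
  simp only [hf] at hik hjl ⊢
  induction l using Fin.lastCases with
  | last =>
    rw [hlast] at hjl
    rcases (Fin.zero_le i).eq_or_lt with h | h
    · subst h; exact r.symm hjl
    · exact r.trans (r.symm (hr _ _ _ _ h hij hjk (r.symm hjl) hik)) (r.symm hjl)
  | cast l =>
    rw [hf] at hjl
    exact hr _ _ _ _ hij hjk (Fin.castSucc_lt_castSucc_iff.1 hkl) hik hjl

/-- There is a map collapsing the position `q` onto its cyclic successor, and pulling back along it
preserves being non-crossing. -/
theorem exists_collapse {n : ℕ} (q : Fin (n + 2)) :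
    ∃ c : Fin (n + 2) → Fin (n + 1), (∀ x, c (q.succAbove x) = x) ∧
      q.succAbove (c q) = finRotate (n + 2) q ∧
      ∀ r : Setoid (Fin (n + 1)), r.NonCrossing → (r.comap c).NonCrossing := by
  induction q using Fin.lastCases with
  | last =>
    refine ⟨Fin.lastCases 0 id, by simp, by simp, fun r hr => ?_⟩
    exact hr.comap_of_last (by simp) (by simp)
  | cast q =>
    refine ⟨Fin.predAbove q, fun x => Fin.predAbove_succAbove _ _, ?_, fun r hr =>
      hr.comap_monotone (Fin.predAbove_right_monotone q)⟩
    rw [Fin.predAbove_castSucc_self, Fin.succAbove_castSucc_self]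
    rw [finRotate_apply, Fin.coeSucc_eq_succ]

/-- Deleting `q` commutes with taking successors, except at the predecessor of `q`, which inherits
the successor of `q`. -/
theorem succAbove_finRotate {n : ℕ} (q : Fin (n + 1)) (x : Fin n) (hx : (x : ℕ) < q) :
    q.succAbove (finRotate n x) = finRotate (n + 1) (q.succAbove x) ∨
      q.succAbove (finRotate n x) = finRotate (n + 1) q ∧
        finRotate (n + 1) (q.succAbove x) = q := by
  obtain _ | n := n
  · exact x.elim0
  have hq := q.is_lt
  have e1 : q.succAbove x = x.castSucc := Fin.succAbove_of_castSucc_lt _ _ hx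
  have e2 : (finRotate (n + 2) x.castSucc : ℕ) = x + 1 := by
    rw [coe_finRotate_of_ne_last (Fin.castSucc_lt_last x).ne]; rfl
  have e3 : (finRotate (n + 1) x : ℕ) = if x = Fin.last n then 0 else (x : ℕ) + 1 :=
    coe_finRotate x
  have e4 : (finRotate (n + 2) q : ℕ) = if q = Fin.last (n + 1) then 0 else (q : ℕ) + 1 :=
    coe_finRotate q
  rw [e1]
  simp only [Fin.ext_iff, e2, e4, Fin.succAbove, Fin.lt_def, Fin.val_castSucc, e3,
    apply_ite Fin.val, Fin.val_succ, Fin.val_last]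
  split_ifs <;> omega

/-- No position among the first `j` is related to its cyclic successor. -/
def NoRelSuccessor {n : ℕ} (j : ℕ) (r : Setoid (Fin n)) : Prop :=
  ∀ i : Fin n, (i : ℕ) < j → ¬ r i (finRotate n i)

/-- In the exceptional case of `succAbove_finRotate` the new successor is related to the old one by
`hq`. -/
theorem noRelSuccessor_comap_succAbove {n : ℕ} (q : Fin (n + 1)) {r : Setoid (Fin (n + 1))}
    (hq : r q (finRotate (n + 1) q)) :
    (r.comap q.succAbove).NoRelSuccessor q ↔ r.NoRelSuccessor q := by
  have key : ∀ x : Fin n, (x : ℕ) < q → (r (q.succAbove x) (q.succAbove (finRotate n x)) ↔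
      r (q.succAbove x) (finRotate (n + 1) (q.succAbove x))) := by
    intro x hx
    rcases succAbove_finRotate q x hx with h | ⟨h, h'⟩
    · rw [h]
    · rw [h, h']
      exact ⟨fun h => r.trans h (r.symm hq), fun h => r.trans h hq⟩
  constructor
  · intro h y hy
    obtain ⟨x, rfl⟩ := Fin.exists_succAbove_eq (Fin.ne_of_lt hy)
    have hx : (x : ℕ) < q := by
      by_contra! hle
      rw [Fin.succAbove_of_le_castSucc _ _ hle, Fin.val_succ] at hy
      omega
    rw [← key x hx]
    exact h x hx
  · intro h x hx
    rw [comap_rel, key x hx]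
    exact h _ (by rwa [Fin.succAbove_of_castSucc_lt _ _ hx])

/-- The inverse is pullback along the map of `exists_collapse`, which gives `q` the class of its
successor. -/
theorem bijOn_comap_succAbove {n : ℕ} (q : Fin (n + 1)) :
    Set.BijOn (fun r : Setoid (Fin (n + 1)) => r.comap q.succAbove)
      {r | r.NonCrossing ∧ r q (finRotate (n + 1) q)} {r | r.NonCrossing} := by
  refine ⟨fun r hr => hr.1.comap_strictMono (Fin.strictMono_succAbove q), ?_, ?_⟩
  -- `exists_collapse` needs a position other than `q`; on `Fin 1`, `q` is its own successor.
  · obtain _ | n := n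
    · intro r _ s _ _
      ext a b
      rw [Subsingleton.elim (α := Fin 1) a b]
      exact iff_of_true (r.refl _) (s.refl _)
    obtain ⟨c, hc, hq, -⟩ := exists_collapse q
    have key : ∀ r : Setoid (Fin (n + 2)), r q (finRotate (n + 2) q) →
        (r.comap q.succAbove).comap c = r := by
      intro r hr
      have h1 : ∀ x, r x (q.succAbove (c x)) := by
        intro x
        rcases eq_or_ne x q with rfl | hx
        · rwa [hq]
        · obtain ⟨y, rfl⟩ := Fin.exists_succAbove_eq hx
          rw [hc]
      ext a b
      exact ⟨fun h => r.trans (h1 a) (r.trans h (r.symm (h1 b))),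
        fun h => r.trans (r.symm (h1 a)) (r.trans h (h1 b))⟩
    intro r hr s hs h
    rw [← key r hr.2, ← key s hs.2]
    exact congrArg (Setoid.comap c) h
  · intro s hs
    obtain _ | n := n
    · refine ⟨⊤, ⟨fun _ _ _ _ _ _ _ _ _ => trivial, trivial⟩, ?_⟩
      ext a
      exact a.elim0
    obtain ⟨c, hc, hq, hnc⟩ := exists_collapse q
    refine ⟨s.comap c, ⟨hnc s hs, ?_⟩, ?_⟩
    · rw [comap_rel, ← hq, hc]
    · ext a b
      simp only [comap_rel, hc]

/-! ### The recurrence in `j` -/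

/-- The number of non-crossing equivalence relations on `Fin n` in which no position among the
first `j` is related to its cyclic successor. -/
noncomputable def nonCrossingCount (n j : ℕ) : ℕ :=
  Set.ncard {r : Setoid (Fin n) | r.NonCrossing ∧ r.NoRelSuccessor j}

theorem ncard_rel_finRotate {n : ℕ} (q : Fin (n + 1)) :
    Set.ncard {r : Setoid (Fin (n + 1)) | (r.NonCrossing ∧ r.NoRelSuccessor q) ∧
      r q (finRotate (n + 1) q)} = nonCrossingCount n q := by
  have hb := bijOn_comap_succAbove q
  refine Set.ncard_congr (fun r _ => r.comap q.succAbove) ?_ ?_ ?_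
  · intro r hr
    exact ⟨hb.mapsTo ⟨hr.1.1, hr.2⟩, (noRelSuccessor_comap_succAbove q hr.2).2 hr.1.2⟩
  · intro r s hr hs h
    exact hb.injOn ⟨hr.1.1, hr.2⟩ ⟨hs.1.1, hs.2⟩ h
  · rintro s ⟨hs, hs'⟩
    obtain ⟨r, hr, rfl⟩ := hb.surjOn hs
    exact ⟨r, ⟨⟨hr.1, (noRelSuccessor_comap_succAbove q hr.2).1 hs'⟩, hr.2⟩, rfl⟩

theorem noRelSuccessor_succ {n : ℕ} (q : Fin n) (r : Setoid (Fin n)) :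
    r.NoRelSuccessor (q + 1) ↔ r.NoRelSuccessor q ∧ ¬ r q (finRotate n q) := by
  constructor
  · exact fun h => ⟨fun i hi => h i (hi.trans (Nat.lt_succ_self _)), h q (Nat.lt_succ_self _)⟩
  · rintro ⟨h, hq⟩ i hi
    rcases (Nat.lt_succ_iff.1 hi).lt_or_eq with hlt | heq
    · exact h i hlt
    · rwa [Fin.ext heq]

theorem nonCrossingCount_succ {n j : ℕ} (hj : j ≤ n) :
    nonCrossingCount (n + 1) (j + 1) + nonCrossingCount n j = nonCrossingCount (n + 1) j := by
  have h := ncard_rel_finRotate (⟨j, Nat.lt_succ_of_le hj⟩ : Fin (n + 1))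
  have h' := noRelSuccessor_succ (⟨j, Nat.lt_succ_of_le hj⟩ : Fin (n + 1))
  simp only at h h'
  rw [← h, nonCrossingCount, nonCrossingCount, add_comm]
  simp only [h', ← and_assoc]
  exact Set.ncard_inter_add_ncard_sdiff_eq_ncard
    {r : Setoid (Fin (n + 1)) | r.NonCrossing ∧ r.NoRelSuccessor j} _

theorem noRelSuccessor_zero {n : ℕ} (r : Setoid (Fin n)) : r.NoRelSuccessor 0 :=
  fun _ h => absurd h (Nat.not_lt_zero _)

theorem ncard_nonCrossing (n : ℕ) :
    Set.ncard {r : Setoid (Fin n) | r.NonCrossing} = nonCrossingCount n 0 := by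
  simp only [nonCrossingCount, noRelSuccessor_zero, and_true]

theorem nonCrossingCount_zero_zero : nonCrossingCount 0 0 = 1 := by
  rw [← ncard_nonCrossing, Set.ncard_eq_one]
  refine ⟨⊤, Set.eq_singleton_iff_unique_mem.2 ⟨fun i => i.elim0, fun r _ => ?_⟩⟩
  ext a
  exact a.elim0

/-! ### The Catalan recursion -/

/-- The cyclic successor of the last position is `0`, so this is again the deletion bijection. -/
theorem ncard_rel_last_zero (m : ℕ) :
    Set.ncard {r : Setoid (Fin (m + 1)) | r.NonCrossing ∧ r (Fin.last m) 0} =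
      nonCrossingCount m 0 := by
  have hb := (bijOn_comap_succAbove (Fin.last m)).ncard_eq
  rwa [finRotate_last, ncard_nonCrossing] at hb

/-- The equivalence relation on `Fin (a + b)` that restricts to `r` on the first `a` elements, to
`s` on the last `b` elements, and relates nothing else. -/
def append {a b : ℕ} (r : Setoid (Fin a)) (s : Setoid (Fin b)) : Setoid (Fin (a + b)) :=
  ker (Fin.addCases (motive := fun _ => Quotient r ⊕ Quotient s) (fun x => Sum.inl ⟦x⟧)
    (fun y => Sum.inr ⟦y⟧))

section Append

variable {a b : ℕ} (r : Setoid (Fin a)) (s : Setoid (Fin b))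

theorem append_rel (x y : Fin (a + b)) : append r s x y ↔
    Fin.addCases (motive := fun _ => Quotient r ⊕ Quotient s) (fun x => Sum.inl ⟦x⟧)
      (fun y => Sum.inr ⟦y⟧) x =
    Fin.addCases (motive := fun _ => Quotient r ⊕ Quotient s) (fun x => Sum.inl ⟦x⟧)
      (fun y => Sum.inr ⟦y⟧) y :=
  Iff.rfl

@[simp]
theorem append_castAdd_castAdd (x y : Fin a) :
    append r s (Fin.castAdd b x) (Fin.castAdd b y) ↔ r x y := by
  simp only [append_rel, Fin.addCases_left, Sum.inl.injEq, Quotient.eq]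

@[simp]
theorem append_natAdd_natAdd (x y : Fin b) :
    append r s (Fin.natAdd a x) (Fin.natAdd a y) ↔ s x y := by
  simp only [append_rel, Fin.addCases_right, Sum.inr.injEq, Quotient.eq]

@[simp]
theorem not_append_castAdd_natAdd (x : Fin a) (y : Fin b) :
    ¬ append r s (Fin.castAdd b x) (Fin.natAdd a y) := by
  simp only [append_rel, Fin.addCases_left, Fin.addCases_right, reduceCtorEq,
    not_false_eq_true]

@[simp]
theorem not_append_natAdd_castAdd (x : Fin a) (y : Fin b) :
    ¬ append r s (Fin.natAdd a y) (Fin.castAdd b x) :=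
  fun h => not_append_castAdd_natAdd r s x y ((append r s).symm h)

variable {r s}

theorem NonCrossing.append (hr : r.NonCrossing) (hs : s.NonCrossing) :
    (append r s).NonCrossing := by
  intro i j k l hij hjk hkl
  induction i using Fin.addCases <;> induction j using Fin.addCases <;>
    induction k using Fin.addCases <;> induction l using Fin.addCases <;>
    first
    | (simp only [append_castAdd_castAdd]
       exact hr _ _ _ _ hij hjk hkl)
    | (simp only [append_natAdd_natAdd]
       simp only [Fin.natAdd_lt_natAdd_iff] at hij hjk hkl
       exact hs _ _ _ _ hij hjk hkl)
    | (intro h1 h2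
       simp at h1 h2
       done)
    | (simp only [Fin.lt_def, Fin.val_castAdd, Fin.val_natAdd] at hij hjk hkl
       omega)

end Append

theorem ncard_nonCrossing_append (m k : ℕ) :
    Set.ncard {r : Setoid (Fin (m + 1 + k)) | r.NonCrossing ∧
      r (Fin.castAdd k (Fin.last m)) (Fin.castAdd k 0) ∧
      ∀ y, ¬ r (Fin.natAdd (m + 1) y) (Fin.castAdd k 0)} =
      nonCrossingCount m 0 * nonCrossingCount k 0 := by
  rw [← ncard_rel_last_zero, ← ncard_nonCrossing, ← Set.ncard_prod]
  refine Set.ncard_congr (fun r _ => (r.comap (Fin.castAdd k), r.comap (Fin.natAdd (m + 1))))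
    ?_ ?_ ?_
  · rintro r ⟨hr, h0, -⟩
    exact ⟨⟨hr.comap_strictMono (Fin.strictMono_castAdd k), h0⟩,
      hr.comap_strictMono (Fin.strictMono_natAdd _)⟩
  -- Nothing links the two sides: a position strictly between `0` and `m` related to one beyond `m`
  -- would interleave with the pair `0, m` and so join the block of `0`.
  · have cut : ∀ r : Setoid (Fin (m + 1 + k)), r.NonCrossing →
        r (Fin.castAdd k (Fin.last m)) (Fin.castAdd k 0) →
        (∀ y, ¬ r (Fin.natAdd (m + 1) y) (Fin.castAdd k 0)) →
        ∀ x y, ¬ r (Fin.castAdd k x) (Fin.natAdd (m + 1) y) := by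
      intro r hr h0 h x y hxy
      apply h y
      rcases (Fin.zero_le x).eq_or_lt with hx | hx
      · rw [hx]; exact r.symm hxy
      rcases (Fin.le_last x).eq_or_lt with hx' | hx'
      · rw [hx'] at hxy
        exact r.trans (r.symm hxy) h0
      exact r.trans (r.symm hxy) (r.symm (hr (Fin.castAdd k 0) (Fin.castAdd k x)
        (Fin.castAdd k (Fin.last m)) (Fin.natAdd (m + 1) y) hx hx'
        (by rw [Fin.lt_def, Fin.val_castAdd, Fin.val_natAdd]; omega) (r.symm h0) hxy))
    rintro r s ⟨hr, hr0, hr'⟩ ⟨hs, hs0, hs'⟩ h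
    have h1 := Setoid.ext_iff.1 (Prod.ext_iff.1 h).1
    have h2 := Setoid.ext_iff.1 (Prod.ext_iff.1 h).2
    have cr := cut r hr hr0 hr'
    have cs := cut s hs hs0 hs'
    ext x y
    induction x using Fin.addCases <;> induction y using Fin.addCases
    · exact h1 _ _
    · exact iff_of_false (cr _ _) (cs _ _)
    · exact iff_of_false (fun h => cr _ _ (r.symm h)) (fun h => cs _ _ (s.symm h))
    · exact h2 _ _
  · rintro ⟨r, s⟩ ⟨⟨hr, hr0⟩, hs⟩
    refine ⟨append r s, ⟨NonCrossing.append hr hs, by simpa using hr0, by simp⟩, ?_⟩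
    ext x y <;> simp only [comap_rel, append_castAdd_castAdd, append_natAdd_natAdd]

theorem ncard_nonCrossing_of_max {n : ℕ} (m : Fin (n + 1)) :
    Set.ncard {r : Setoid (Fin (n + 1)) | r.NonCrossing ∧ r m 0 ∧ ∀ y, m < y → ¬ r y 0} =
      nonCrossingCount m 0 * nonCrossingCount (n - m) 0 := by
  obtain ⟨m, hm⟩ := m
  obtain ⟨k, hk⟩ := Nat.exists_eq_add_of_le (Nat.succ_le_of_lt hm)
  -- A free `N` allows substituting `m + 1 + k` for the size without casts.
  have key : ∀ (N : ℕ) (hN : N = m + 1 + k) (h1 : m < N) (h0 : 0 < N),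
      Set.ncard {r : Setoid (Fin N) | r.NonCrossing ∧ r ⟨m, h1⟩ ⟨0, h0⟩ ∧
        ∀ y : Fin N, m < (y : ℕ) → ¬ r y ⟨0, h0⟩} =
      nonCrossingCount m 0 * nonCrossingCount k 0 := by
    rintro N rfl h1 h0
    rw [← ncard_nonCrossing_append]
    congr 1
    ext r
    refine and_congr_right fun _ => and_congr_right fun _ => ⟨fun h y => h _ ?_, fun h y => ?_⟩
    · rw [Fin.val_natAdd]; omega
    · induction y using Fin.addCases with
      | left y => intro hy; rw [Fin.val_castAdd] at hy; omega
      | right y => exact fun _ => h y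
  have := key (n + 1) hk hm n.succ_pos
  rw [show n - m = k by omega]
  exact this

/-- Relations are sorted by the largest element `m` of the block of `0`. -/
theorem nonCrossingCount_eq_catalan (n : ℕ) : nonCrossingCount n 0 = catalan n := by
  induction n using Nat.strong_induction_on with
  | _ n ih =>
  obtain _ | n := n
  · rw [nonCrossingCount_zero_zero, catalan_zero]
  rw [catalan_succ, ← ncard_nonCrossing]
  have hU : {r : Setoid (Fin (n + 1)) | r.NonCrossing} = ⋃ m : Fin (n + 1),
      {r : Setoid (Fin (n + 1)) | r.NonCrossing ∧ r m 0 ∧ ∀ y, m < y → ¬ r y 0} := by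
    ext r
    simp only [Set.mem_ofPred_eq, Set.mem_iUnion]
    refine ⟨fun hr => ?_, fun ⟨_, h⟩ => h.1⟩
    obtain ⟨m, hm, hmax⟩ := Set.exists_max_image {y | r y 0} id (Set.toFinite _) ⟨0, r.refl 0⟩
    exact ⟨m, hr, hm, fun y hy h => not_le.2 hy (hmax y h)⟩
  rw [hU, Set.ncard_iUnion_of_finite (fun _ => Set.toFinite _), finsum_eq_sum_of_fintype]
  · refine Finset.sum_congr rfl fun m _ => ?_
    rw [ncard_nonCrossing_of_max, ih m m.is_lt, ih (n - m) (by omega)]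
  · intro m m' hmm
    refine Set.disjoint_left.2 fun r hr hr' => ?_
    rcases lt_or_gt_of_ne hmm with h | h
    · exact hr.2.2 _ h hr'.2.1
    · exact hr'.2.2 _ h hr.2.1

/-! ### Closed form and conclusion -/

theorem nonCrossingCount_eq_sum (n j : ℕ) (hj : j ≤ n) : (nonCrossingCount n j : ℤ) =
    ∑ i ∈ range (j + 1), (-1 : ℤ) ^ i * (j.choose i : ℤ) * (catalan (n - i) : ℤ) := by
  induction j generalizing n with
  | zero => simp [nonCrossingCount_eq_catalan]
  | succ j ih =>
    obtain _ | n := n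
    · omega
    have h := nonCrossingCount_succ (Nat.le_of_succ_le_succ hj)
    have h' : (nonCrossingCount (n + 1) (j + 1) : ℤ) =
        nonCrossingCount (n + 1) j - nonCrossingCount n j := by
      rw [← h]; push_cast; ring
    rw [h', ih (n + 1) (by omega), ih n (by omega), sum_range_succ' _ (j + 1),
      ← add_zero (∑ i ∈ range (j + 1), _ * _ * (catalan (n + 1 - i) : ℤ))]
    -- A vanishing term, as `j.choose (j + 1) = 0`, gives the first sum the extra index needed to
    -- apply Pascal's rule termwise.
    have h0 : (0 : ℤ) = (-1 : ℤ) ^ (j + 1) * (j.choose (j + 1) : ℤ) *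
        (catalan (n + 1 - (j + 1)) : ℤ) := by simp
    rw [h0, ← sum_range_succ, sum_range_succ' _ (j + 1), add_sub_right_comm, ← sum_sub_distrib]
    rw [Nat.choose_zero_right, Nat.choose_zero_right]
    congr 1
    refine sum_congr rfl fun i _ => ?_
    rw [Nat.choose_succ_succ', Nat.add_sub_add_right]
    push_cast
    ring

end Setoid

theorem card_nonCrossing_noEqualSuccessor (n j : ℕ) :
    Nat.card {P : Finpartition (univ : Finset (Fin n)) //
      IsNonCrossing P ∧ NoEqualSuccessorAmongFirst j (canonicalWord P)} =
      Setoid.nonCrossingCount n j := by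
  rw [Setoid.nonCrossingCount, ← Nat.card_coe_set_eq]
  refine Nat.card_congr ((finpartitionEquivSetoid (Fin n)).subtypeEquiv fun P => ?_)
  refine and_congr (isNonCrossing_iff P) (forall_congr' fun i => imp_congr_right fun _ => ?_)
  rw [Ne, canonicalWord_eq_iff]
  rfl

theorem mainTheorem4 :
    (∀ n : ℕ,
      (Nat.card {P : Finpartition (univ : Finset (Fin n)) //
        IsNonCrossing P ∧ NoEqualCyclicallyAdjacent (canonicalWord P)} : ℤ) =
        catalanDifference n) ∧
    (∀ n j : ℕ, j ≤ n →
      (Nat.card {P : Finpartition (univ : Finset (Fin n)) //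
        IsNonCrossing P ∧ NoEqualSuccessorAmongFirst j (canonicalWord P)} : ℤ) =
        ∑ i ∈ range (j + 1), (-1 : ℤ) ^ i * (j.choose i : ℤ) * (catalan (n - i) : ℤ)) := by
  have key (n j : ℕ) (hj : j ≤ n) := (congrArg (Nat.cast (R := ℤ))
    (card_nonCrossing_noEqualSuccessor n j)).trans (Setoid.nonCrossingCount_eq_sum n j hj)
  refine ⟨fun n => ?_, key⟩
  have hcyc (w : Fin n → ℕ) : NoEqualCyclicallyAdjacent w ↔ NoEqualSuccessorAmongFirst n w :=
    forall_congr' fun i => ⟨fun h _ => h, fun h => h i.is_lt⟩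
  simp only [hcyc]
  rw [key n n le_rfl, catalanDifference, ← sum_range_reflect]
  refine sum_congr rfl fun i hi => ?_
  have hi : i ≤ n := Nat.lt_succ_iff.1 (mem_range.1 hi)
  rw [Nat.add_sub_cancel, Nat.choose_symm hi, Nat.sub_sub_self hi]
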